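/- Let $n\ge 0$. Let $R$ be the union of the unit squares ("boxes"), rotated by $45^\circ$, with centres $(x,y)\in\mathbb{Z}^2$ such that $x\ge 0$, $y\ge 1$, $x+y$ is odd and $x+y\le 2n-1$; the box with centre $(x,y)$ has corners $(x\pm1,y)$, $(x,y\pm1)$. Thus $R$ is the region bounded by the zigzag path $\lambda_b$ through $(0,0),(1,1),(2,0),(3,1),\ldots,(2n,0)$, the segment from $(0,2n)$ to $(2n,0)$ and the line $x=0$, together with the whole of the boxes centred on $x=0$. The latter, the anchor boxes, are labelled $1,\ldots,n$ from top to bottom. A Dyck tile is a ribbon of boxes whose centres, joined successively by a line, form a Dyck path (with steps $(1,1)$ and $(1,-1)$); its size is $k$ if this Dyck path has $2k$ steps, so a single box has size $0$. A cover-inclusive Dyck tiling of $R$ is a tiling of $R$ by Dyck tiles such that each tile, moved by $(0,-2)$, is contained in another tile or lies below $\lambda_b$. The entry of a tile is the upper left edge of its leftmost box, and its exit is the lower right edge of its rightmost box. The trajectory of label $i$ enters the tile whose leftmost box is the anchor box labelled $i$ at its entry, leaves it at its exit, continues into the tile whose entry is that edge, if there is one, and so on; it ends at the exit of the last tile reached.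 Write $i$ at the peak of $\lambda_b$ that lies on the vertical line through the upper end point of this last edge. A tiling corresponds to the permutation $w=w_1\cdots w_n$ of $\{1,\ldots,n\}$ if the labels written at the $n$ peaks of $\lambda_b$, read from right to left, are $w_1,\ldots,w_n$. Let $S_n(231)$ be the set of permutations $w$ of $\{1,\ldots,n\}$ for which there are no $i<j<k$ with $w_k<w_i<w_j$. For a tiling $D$ let $\mathrm{wt}'(D)$ be the sum of the sizes of its tiles. Let $C_0(q),C_1(q),\ldots\in\mathbb{Z}[q]$ be defined by the identity of formal power series $$z=\sum_{m\ge1}C_{m-1}(q)\,z^m(1-z)(1-qz)\cdots(1-q^{m-1}z).$$ Then to each permutation $w$ of $\{1,\ldots,n\}$ there corresponds exactly one cover-inclusive Dyck tiling $D(w)$ of $R$, and, in $\mathbb{Z}[q,q^{-1}]$, $$\sum_{w\in S_n(231)}q^{\mathrm{wt}'(D(w))}=q^{\binom n2}\,C_n(q^{-1}).$$ -/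

import Mathlib

open scoped Polynomial PowerSeries LaurentPolynomial

noncomputable section

/-- A unit square (rotated by 45 degrees), represented by the coordinates of its centre `(x, y)`.
Its corners are `(x - 1, y)`, `(x, y + 1)`, `(x + 1, y)`, `(x, y - 1)`. -/
abbrev Box : Type := ℤ × ℤ

/-- An up step, that is a segment from `(x, y)` to `(x + 1, y + 1)`, represented by its lower left
end point `(x, y)`. -/
abbrev UpStep : Type := ℤ × ℤ

/-- The boxes of the region bounded by the zigzag path `(0,0), (1,1), (2,0), …, (2n,0)`, the
line segment from `(0, 2n)` to `(2n, 0)` and the line `x = 0`. The boxes with centre on the line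
`x = 0` (the anchor boxes) belong to the region. -/
def region (n : ℕ) : Set Box :=
  {b | 0 ≤ b.1 ∧ 1 ≤ b.2 ∧ b.1 + b.2 ≤ 2 * (n : ℤ) - 1 ∧ Odd (b.1 + b.2)}

/-- A Dyck tile: a ribbon of boxes such that the line through the centres of its boxes
is a Dyck path. It is given by its leftmost box and by that Dyck path. -/
@[ext]
structure DyckTile where
  /-- the leftmost box -/
  start : Box
  /-- the Dyck path (possibly empty) formed by the centres of the boxes -/
  path : DyckWord

namespace DyckTile

/-- The centre of the `i`-th box of a tile: the end point of the first `i` steps of the path. -/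
def boxAt (d : DyckTile) (i : ℕ) : Box :=
  (d.start.1 + i,
    d.start.2 + ((d.path.toList.take i).count DyckStep.U : ℤ)
      - ((d.path.toList.take i).count DyckStep.D : ℤ))

/-- The set of boxes of a tile. -/
def boxes (d : DyckTile) : Set Box :=
  {b | ∃ i ≤ d.path.toList.length, b = d.boxAt i}

/-- The size of a tile is the size of its Dyck path (a single box has size zero). -/
def size (d : DyckTile) : ℕ := d.path.semilength

/-- The leftmost up step on the boundary of a tile: the upper left edge of its leftmost box. -/
def entry (d : DyckTile) : UpStep := (d.start.1 - 1, d.start.2)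

/-- The rightmost up step on the boundary of a tile: the lower right edge of its rightmost box. -/
def exit (d : DyckTile) : UpStep :=
  ((d.boxAt d.path.toList.length).1, (d.boxAt d.path.toList.length).2 - 1)

end DyckTile

/-- Translation of a set of boxes by `(0, -2)`. -/
def moveDown (s : Set Box) : Set Box := {b | (b.1, b.2 + 2) ∈ s}

/-- The boxes whose interior lies below the zigzag path. -/
def belowZigzag : Set Box := {b | b.2 ≤ 0}

/-- The cover-inclusive Dyck tilings of the region: a set of Dyck tiles contained in the region,
covering each box of the region exactly once, such that each tile, moved down by `(0, -2)`,
is contained in a tile or lies below the zigzag path. -/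
@[ext]
structure DyckTiling (n : ℕ) where
  /-- the tiles of the tiling -/
  tiles : Finset DyckTile
  subset_region : ∀ d ∈ tiles, d.boxes ⊆ region n
  tiling : ∀ b ∈ region n, ∃! d, d ∈ tiles ∧ b ∈ d.boxes
  cover_inclusive : ∀ d ∈ tiles,
    (∃ d' ∈ tiles, moveDown d.boxes ⊆ d'.boxes) ∨ moveDown d.boxes ⊆ belowZigzag

namespace DyckTiling

variable {n : ℕ}

/-- The anchor box labelled `i + 1`; the labels `1, …, n` increase from top to bottom. -/
def anchorBox (n : ℕ) (i : Fin n) : Box := (0, 2 * ((n : ℤ) - 1 - (i : ℤ)) + 1)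

/-- The trajectory which starts at the entry of the anchor box labelled `i + 1` ends at the
up step `u`. The trajectory enters a tile at its entry, leaves it at its exit, and is continued
into the next tile whenever this exit is the entry of another tile of the tiling. -/
def TrajectoryEndsAt (T : DyckTiling n) (i : Fin n) (u : UpStep) : Prop :=
  ∃ d₀ ∈ T.tiles, ∃ d ∈ T.tiles,
    d₀.start = anchorBox n i ∧
    Relation.ReflTransGen (fun e e' => e' ∈ T.tiles ∧ e.exit = e'.entry) d₀ d ∧
    (∀ d' ∈ T.tiles, d.exit ≠ d'.entry) ∧
    u = d.exit

/-- The `x`-coordinate of the `(j + 1)`-st peak, counted from right to left, of the zigzag path,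
whose peaks are `(1, 1), (3, 1), …, (2n - 1, 1)`. -/
def peakX (n : ℕ) (j : Fin n) : ℤ := 2 * ((n : ℤ) - 1 - (j : ℤ)) + 1

/-- The tiling `T` corresponds to the permutation `w`: for each `j`, the trajectory that starts
at the anchor box labelled by the `j`-th letter of `w` ends at an up step (of the zigzag path or
of a tile) whose upper end point lies on the vertical line through the `j`-th peak from the right,
so that reading the labels of the peaks from right to left gives `w`. -/
def Corresponds (T : DyckTiling n) (w : Equiv.Perm (Fin n)) : Prop :=
  ∀ j : Fin n, ∃ u : UpStep, T.TrajectoryEndsAt (w j) u ∧ u.1 + 1 = peakX n j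

/-- The weight of a tiling: the sum of the sizes of its tiles. -/
def weight (T : DyckTiling n) : ℕ := ∑ d ∈ T.tiles, d.size

end DyckTiling

/-- The permutations `w` of `n` letters without `i < j < k` such that `w k < w i < w j`. -/
def perms231Avoiding (n : ℕ) : Finset (Equiv.Perm (Fin n)) :=
  Finset.univ.filter fun w => ∀ i j k : Fin n, i < j → j < k → ¬ (w k < w i ∧ w i < w j)

/-- The product `(1 - z)(1 - q z) ⋯ (1 - q ^ (k - 1) z)` as a power series in `z` over `ℤ[q]`. -/
def qPochhammer (k : ℕ) : ℤ[X]⟦X⟧ :=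
  ∏ i ∈ Finset.range k, (1 - PowerSeries.C ((Polynomial.X : ℤ[X]) ^ i) * PowerSeries.X)

/-- The identity of formal power series
`z = ∑_{m ≥ 1} c (m - 1) z ^ m (1 - z)(1 - q z) ⋯ (1 - q ^ (m - 1) z)` over `ℤ[q]`: for each `k`,
the coefficient of `z ^ k` in the partial sums is eventually that of `z`. -/
def IsQCatalanSeq (c : ℕ → ℤ[X]) : Prop :=
  ∀ k N : ℕ, k ≤ N →
    PowerSeries.coeff k
      (∑ m ∈ Finset.Icc 1 N, PowerSeries.C (c (m - 1)) * PowerSeries.X ^ m * qPochhammer m)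
    = PowerSeries.coeff k (PowerSeries.X : ℤ[X]⟦X⟧)

/-- The `q`-Catalan number `C_m(q)`: the unique sequence that satisfies `IsQCatalanSeq`, solved
for its terms by comparing coefficients of `z ^ (m + 1)`. -/
def qCatalan (m : ℕ) : ℤ[X] :=
  (if m = 0 then 1 else 0)
    - ∑ k : Fin m, qCatalan k * PowerSeries.coeff (m - (k : ℕ)) (qPochhammer ((k : ℕ) + 1))
  termination_by m
  decreasing_by exact k.2

theorem coeff_partialSum (c : ℕ → ℤ[X]) {k N : ℕ} (h : k ≤ N) :
    PowerSeries.coeff k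
      (∑ m ∈ Finset.Icc 1 N, PowerSeries.C (c (m - 1)) * PowerSeries.X ^ m * qPochhammer m)
    = ∑ i ∈ Finset.range k, c i * PowerSeries.coeff (k - (i + 1)) (qPochhammer (i + 1)) := by
  have h1 : Finset.Icc 1 N = (Finset.range N).image (· + 1) := by
    ext a
    simp only [Finset.mem_Icc, Finset.mem_image, Finset.mem_range]
    constructor
    · rintro ⟨h1, h2⟩
      exact ⟨a - 1, by omega, by omega⟩
    · rintro ⟨b, hb, rfl⟩
      omega
  rw [h1, Finset.sum_image (by intro a _ b _ hab; simpa using hab), map_sum,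
    ← Finset.sum_subset (Finset.range_subset_range.2 h)]
  · refine Finset.sum_congr rfl fun i hi => ?_
    rw [mul_assoc, PowerSeries.coeff_C_mul, PowerSeries.coeff_X_pow_mul',
      if_pos (by simpa [Nat.succ_le_iff] using hi)]
    simp
  · intro i _ hi
    rw [mul_assoc, PowerSeries.coeff_C_mul, PowerSeries.coeff_X_pow_mul', if_neg, mul_zero]
    simpa [Nat.succ_le_iff] using hi

theorem qPochhammer_coeff_zero (k : ℕ) : PowerSeries.coeff 0 (qPochhammer k) = 1 := by
  simp [qPochhammer, PowerSeries.coeff_zero_eq_constantCoeff, map_prod]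

theorem isQCatalanSeq_iff (c : ℕ → ℤ[X]) : IsQCatalanSeq c ↔
    ∀ m, c m = (if m = 0 then 1 else 0)
      - ∑ k : Fin m, c k * PowerSeries.coeff (m - (k : ℕ)) (qPochhammer ((k : ℕ) + 1)) := by
  have key : ∀ m, ∑ i ∈ Finset.range (m + 1),
      c i * PowerSeries.coeff (m + 1 - (i + 1)) (qPochhammer (i + 1))
      = (∑ k : Fin m, c k * PowerSeries.coeff (m - (k : ℕ)) (qPochhammer ((k : ℕ) + 1))) + c m := by
    intro m
    rw [Finset.sum_range_succ, Fin.sum_univ_eq_sum_range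
      (fun k => c k * PowerSeries.coeff (m - k) (qPochhammer (k + 1)))]
    simp only [Nat.add_sub_add_right, Nat.sub_self, qPochhammer_coeff_zero, mul_one]
  constructor
  · intro h m
    have := h (m + 1) (m + 1) le_rfl
    rw [coeff_partialSum c le_rfl, key, PowerSeries.coeff_X] at this
    simp only [Nat.add_eq_right] at this
    rw [← this]
    ring
  · intro h k N hk
    rw [coeff_partialSum c hk]
    cases k with
    | zero => simp [PowerSeries.coeff_X]
    | succ m =>
      rw [key, PowerSeries.coeff_X]
      simp only [Nat.add_eq_right]
      conv_lhs => rw [h m]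
      ring

/-- The `q`-Catalan numbers satisfy their defining identity. -/
theorem qCatalan_isQCatalanSeq : IsQCatalanSeq qCatalan :=
  (isQCatalanSeq_iff qCatalan).2 fun m => by rw [qCatalan]

/-- The `q`-Catalan numbers are the only solution of their defining identity. -/
theorem IsQCatalanSeq.eq_qCatalan {c : ℕ → ℤ[X]} (h : IsQCatalanSeq c) : c = qCatalan := by
  rw [isQCatalanSeq_iff] at h
  funext m
  induction m using Nat.strong_induction_on with
  | _ m ih =>
    rw [h m, qCatalan]
    congr 1
    exact Finset.sum_congr rfl fun k _ => by rw [ih k k.2]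

end

/-! Cover-inclusiveness over a zigzag boundary is rigid. By induction on height, every tile is
either a zigzag `(UD)^k` starting at odd height or a single box at even height
(`DyckTiling.eq_oddTile_or_eq_evenTile`). Let `c b` count the odd rows in which the boxes of columns
`2b` and `2b + 2` lie in one tile. These rows are the lowest `c b` ones, so the sequence `c`
determines the tiling. Conversely every `c` satisfying `IsCode` occurs, and the weight is the sum of
the `c b`.

Given `w`, let `c b` be the number of larger letters before position `n - 1 - b`. Then the
trajectory of `w j` stays in its row when it passes a smaller letter and drops one row when it
passes a larger one. It stops in the column of position `j`, so this tiling corresponds to `w`.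
Trajectories are deterministic, hence a tiling corresponds to at most one permutation. Together with
the count `n!` of inversion tables, this makes the correspondence bijective (`corresponds_iff`).

Finally, `w` avoids 231 exactly when its counts `e i` of smaller letters to the left increase
weakly. These counts add up to `n.choose 2` minus the weight. So the sum is `q ^ (n.choose 2)`
times, at `q⁻¹`, the generating function by sum of weakly increasing sequences with `e i ≤ i`. That
this generating function is `qCatalan` follows from the defining identity by a telescoping summation
by parts (`boundedSum_mul_coeff`, `sum_boundedSum_mul_coeff`). -/

/-! ### Zigzag words and zigzag tiles -/

/-- The Dyck word `(UD)^k`. -/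
def zigzagWord : ℕ → DyckWord
  | 0 => 0
  | k + 1 => DyckWord.nest 0 + zigzagWord k

theorem zigzagWord_succ_toList (k : ℕ) :
    (zigzagWord (k + 1)).toList = DyckStep.U :: DyckStep.D :: (zigzagWord k).toList := rfl

theorem length_zigzagWord (k : ℕ) : (zigzagWord k).toList.length = 2 * k := by
  induction k with
  | zero => rfl
  | succ k ih => simp [zigzagWord_succ_toList, ih]; ring

theorem semilength_zigzagWord (k : ℕ) : (zigzagWord k).semilength = k := by
  have h := (zigzagWord k).two_mul_semilength_eq_length
  rw [length_zigzagWord] at h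
  omega

theorem count_take_zigzagWord (k i : ℕ) (h : i ≤ 2 * k) :
    ((zigzagWord k).toList.take i).count DyckStep.U
      = ((zigzagWord k).toList.take i).count DyckStep.D + i % 2 := by
  induction k generalizing i with
  | zero => obtain rfl : i = 0 := by omega
            simp
  | succ k ih =>
    match i with
    | 0 => simp
    | 1 => simp [zigzagWord_succ_toList]
    | i + 2 =>
      have := ih i (by omega)
      simp [zigzagWord_succ_toList, this]
      omega

/-- A path confined to heights 0 and 1 has no choice: it alternates `U` and `D`. -/
theorem exists_toList_eq_zigzagWord (l : List DyckStep)
    (h0 : ∀ i, (l.take i).count DyckStep.D ≤ (l.take i).count DyckStep.U)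
    (h1 : ∀ i, (l.take i).count DyckStep.U ≤ (l.take i).count DyckStep.D + 1)
    (h2 : l.count DyckStep.U = l.count DyckStep.D) :
    ∃ k, l = (zigzagWord k).toList := by
  match l with
  | [] => exact ⟨0, rfl⟩
  | [a] => cases a <;> simp at h2
  | a :: b :: t =>
    have ha : a = DyckStep.U := by
      have := h0 1
      cases a <;> simp_all
    subst ha
    have hb : b = DyckStep.D := by
      have := h1 2
      cases b <;> simp_all
    subst hb
    obtain ⟨k, hk⟩ := exists_toList_eq_zigzagWord t
      (fun i => by simpa using h0 (i + 2)) (fun i => by simpa using h1 (i + 2))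
      (by simpa using h2)
    exact ⟨k + 1, by rw [zigzagWord_succ_toList, hk]⟩

theorem mem_moveDown {s : Set Box} {b : Box} : b ∈ moveDown s ↔ (b.1, b.2 + 2) ∈ s := Iff.rfl

theorem mem_region {n : ℕ} {b : Box} : b ∈ region n ↔
    0 ≤ b.1 ∧ 1 ≤ b.2 ∧ b.1 + b.2 ≤ 2 * (n : ℤ) - 1 ∧ Odd (b.1 + b.2) := Iff.rfl

namespace DyckTile

theorem boxAt_zero (d : DyckTile) : d.boxAt 0 = d.start := by simp [boxAt]

theorem start_mem_boxes (d : DyckTile) : d.start ∈ d.boxes := ⟨0, Nat.zero_le _, d.boxAt_zero.symm⟩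

theorem start_le_of_mem_boxes {d : DyckTile} {b : Box} (h : b ∈ d.boxes) :
    d.start.1 ≤ b.1 ∧ d.start.2 ≤ b.2 := by
  obtain ⟨i, -, rfl⟩ := h
  have := d.path.count_D_le_count_U i
  simp only [boxAt]
  omega

/-- The tile with leftmost box `s` and path `(UD)^k`. -/
def zigzag (s : Box) (k : ℕ) : DyckTile := ⟨s, zigzagWord k⟩

@[simp] theorem zigzag_start (s : Box) (k : ℕ) : (zigzag s k).start = s := rfl

@[simp] theorem zigzag_size (s : Box) (k : ℕ) : (zigzag s k).size = k := semilength_zigzagWord k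

@[simp] theorem zigzag_entry (s : Box) (k : ℕ) : (zigzag s k).entry = (s.1 - 1, s.2) := rfl

theorem zigzag_boxAt (s : Box) {k i : ℕ} (h : i ≤ 2 * k) :
    (zigzag s k).boxAt i = (s.1 + i, s.2 + (i % 2 : ℕ)) := by
  have := count_take_zigzagWord k i h
  simp only [boxAt, zigzag, this]
  ext
  · simp
  · push_cast
    ring

@[simp] theorem zigzag_exit (s : Box) (k : ℕ) :
    (zigzag s k).exit = (s.1 + 2 * k, s.2 - 1) := by
  have : (zigzag s k).path.toList.length = 2 * k := length_zigzagWord k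
  rw [exit, this, zigzag_boxAt s le_rfl]
  simp

theorem mem_zigzag_boxes {s : Box} {k : ℕ} {b : Box} :
    b ∈ (zigzag s k).boxes ↔ ∃ i ≤ 2 * k, b = (s.1 + (i : ℤ), s.2 + (i % 2 : ℕ)) := by
  have : (zigzag s k).path.toList.length = 2 * k := length_zigzagWord k
  simp only [boxes, this, Set.mem_ofPred_eq]
  refine exists_congr fun i => and_congr_right fun hi => ?_
  rw [zigzag_boxAt s hi]

/-- A tile whose boxes have at most two different heights is a zigzag. -/
theorem exists_eq_zigzag (d : DyckTile) (h : ∀ b ∈ d.boxes, b.2 ≤ d.start.2 + 1) :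
    ∃ k, d = zigzag d.start k := by
  obtain ⟨k, hk⟩ := exists_toList_eq_zigzagWord d.path.toList d.path.count_D_le_count_U
    (fun i => by
      rcases le_total i d.path.toList.length with hi | hi
      · have := h _ ⟨i, hi, rfl⟩
        simp only [boxAt] at this
        omega
      · rw [List.take_of_length_le hi, d.path.count_U_eq_count_D]
        omega) d.path.count_U_eq_count_D
  exact ⟨k, DyckTile.ext rfl (DyckWord.ext hk)⟩

end DyckTile

/-! ### From codes to tilings -/

/-- The sequences `c` with `c b + b < n` or `c b = 0` for all `b`. -/
def IsCode (n : ℕ) (c : ℕ → ℕ) : Prop := ∀ b r, r < c b → b + r + 1 < n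

/-- The interval `[i, i + k]` is a maximal one with `r < c b` for all `b ∈ [i, i + k)`. -/
def IsRun (c : ℕ → ℕ) (r i k : ℕ) : Prop :=
  (∀ b, b + 1 = i → c b ≤ r) ∧ (∀ b, i ≤ b → b < i + k → r < c b) ∧ c (i + k) ≤ r

/-- The zigzag tile of size `k` that starts in column `i` of the `r`-th row of odd height. -/
def oddTile (r i k : ℕ) : DyckTile := .zigzag (2 * (i : ℤ), 2 * (r : ℤ) + 1) k

/-- The single box at column `b` of the `r`-th row of even height. -/
def evenTile (r b : ℕ) : DyckTile := .zigzag (2 * (b : ℤ) + 1, 2 * (r : ℤ) + 2) 0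

theorem mem_oddTile {r i k : ℕ} {b : Box} : b ∈ (oddTile r i k).boxes ↔
    (∃ a : ℕ, i ≤ a ∧ a ≤ i + k ∧ b = (2 * (a : ℤ), 2 * (r : ℤ) + 1)) ∨
    (∃ a : ℕ, i ≤ a ∧ a < i + k ∧ b = (2 * (a : ℤ) + 1, 2 * (r : ℤ) + 2)) := by
  rw [oddTile, DyckTile.mem_zigzag_boxes]
  constructor
  · rintro ⟨j, hj, rfl⟩
    obtain ⟨a, rfl | rfl⟩ := Nat.even_or_odd' j
    · refine Or.inl ⟨i + a, by omega, by omega, ?_⟩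
      ext <;> push_cast <;> omega
    · refine Or.inr ⟨i + a, by omega, by omega, ?_⟩
      ext <;> push_cast <;> omega
  · rintro (⟨a, h1, h2, rfl⟩ | ⟨a, h1, h2, rfl⟩)
    · refine ⟨2 * (a - i), by omega, ?_⟩
      ext <;> push_cast <;> omega
    · refine ⟨2 * (a - i) + 1, by omega, ?_⟩
      ext <;> push_cast <;> omega

theorem mem_evenTile {r a : ℕ} {b : Box} : b ∈ (evenTile r a).boxes ↔
    b = (2 * (a : ℤ) + 1, 2 * (r : ℤ) + 2) := by
  simp [evenTile, DyckTile.mem_zigzag_boxes]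

/-- Indices of `c` are links between neighbouring odd-row boxes, so a run of `k` links joins the `k
+ 1` boxes `i, …, i + k`. This is why the right end is included, and a run with `k = 0` is a lone
box. -/
theorem exists_isRun {n : ℕ} {c : ℕ → ℕ} (hc : IsCode n c) (r a : ℕ) :
    ∃ i k, IsRun c r i k ∧ i ≤ a ∧ a ≤ i + k := by
  have h1 : ∃ i ≤ a, (∀ b, b + 1 = i → c b ≤ r) ∧ ∀ b, i ≤ b → b < a → r < c b := by
    induction a with
    | zero => exact ⟨0, le_rfl, by omega, by omega⟩
    | succ a ih =>
      rcases le_or_gt (c a) r with h | h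
      · exact ⟨a + 1, le_rfl, fun b hb => by obtain rfl : b = a := by omega
                                             exact h, by omega⟩
      · obtain ⟨i, hi, h2, h3⟩ := ih
        refine ⟨i, by omega, h2, fun b hb hb' => ?_⟩
        rcases Nat.lt_succ_iff_lt_or_eq.1 hb' with h4 | rfl
        · exact h3 b hb h4
        · exact h
  have h2 : ∃ e, a ≤ e ∧ c e ≤ r := by
    -- A code vanishes from index `n` on, so every run stops.
    refine ⟨a + n, by omega, ?_⟩
    by_contra h
    have := hc _ _ (not_le.1 h)
    omega
  obtain ⟨i, hi, h3, h4⟩ := h1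
  classical
  obtain ⟨h5, h6⟩ := Nat.find_spec h2
  refine ⟨i, Nat.find h2 - i, ⟨h3, fun b hb hb' => ?_, ?_⟩, hi, by omega⟩
  · rcases lt_or_ge b a with h | h
    · exact h4 b hb h
    · have := Nat.find_min h2 (m := b) (by omega)
      by_contra h7
      exact this ⟨h, not_lt.1 h7⟩
  · rwa [Nat.add_sub_cancel' (hi.trans h5)]

theorem IsRun.unique {c : ℕ → ℕ} {r i k i' k' a : ℕ} (h : IsRun c r i k) (h' : IsRun c r i' k')
    (h1 : i ≤ a) (h2 : a ≤ i + k) (h1' : i' ≤ a) (h2' : a ≤ i' + k') : i = i' ∧ k = k' := by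
  have key : ∀ {i k i' k' : ℕ}, IsRun c r i k → IsRun c r i' k' → i ≤ a → a ≤ i + k → i' ≤ a →
      a ≤ i' + k' → i ≤ i' ∧ i + k ≤ i' + k' := by
    intro i k i' k' h h' h1 h2 h1' h2'
    constructor
    · by_contra h3
      have h4 := h'.2.1 (i - 1) (by omega) (by omega)
      have h5 := h.1 (i - 1) (by omega)
      omega
    · by_contra h3
      have h4 := h.2.1 (i' + k') (by omega) (by omega)
      have h5 := h'.2.2
      omega
  have := key h h' h1 h2 h1' h2'
  have := key h' h h1' h2' h1 h2
  omega

open Classical in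
/-- The tiles of the tiling with code `c`. -/
noncomputable def codeTiles (n : ℕ) (c : ℕ → ℕ) : Finset DyckTile :=
  ((Finset.range n ×ˢ Finset.range n ×ˢ Finset.range n).filter fun p =>
      p.2.1 + p.2.2 + p.1 < n ∧ IsRun c p.1 p.2.1 p.2.2).image (fun p => oddTile p.1 p.2.1 p.2.2)
    ∪ ((Finset.range n ×ˢ Finset.range n).filter fun p =>
      p.2 + p.1 + 1 < n ∧ c p.2 ≤ p.1).image (fun p => evenTile p.1 p.2)

theorem mem_codeTiles {n : ℕ} {c : ℕ → ℕ} {d : DyckTile} : d ∈ codeTiles n c ↔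
    (∃ r i k, i + k + r < n ∧ IsRun c r i k ∧ d = oddTile r i k) ∨
    (∃ r b, b + r + 1 < n ∧ c b ≤ r ∧ d = evenTile r b) := by
  simp only [codeTiles, Finset.mem_union, Finset.mem_image, Finset.mem_filter, Finset.mem_product,
    Finset.mem_range, Prod.exists]
  refine or_congr ⟨?_, ?_⟩ ⟨?_, ?_⟩
  · rintro ⟨r, i, k, ⟨-, h1, h2⟩, rfl⟩
    exact ⟨r, i, k, h1, h2, rfl⟩
  · rintro ⟨r, i, k, h1, h2, rfl⟩
    exact ⟨r, i, k, ⟨⟨by omega, by omega, by omega⟩, h1, h2⟩, rfl⟩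
  · rintro ⟨r, b, ⟨-, h1, h2⟩, rfl⟩
    exact ⟨r, b, h1, h2, rfl⟩
  · rintro ⟨r, b, h1, h2, rfl⟩
    exact ⟨r, b, ⟨⟨by omega, by omega⟩, h1, h2⟩, rfl⟩

theorem exists_coords_of_mem_region {n : ℕ} {b : Box} (h : b ∈ region n) :
    (∃ a r : ℕ, a + r < n ∧ b = (2 * (a : ℤ), 2 * (r : ℤ) + 1)) ∨
    (∃ a r : ℕ, a + r + 1 < n ∧ b = (2 * (a : ℤ) + 1, 2 * (r : ℤ) + 2)) := by
  obtain ⟨x, y⟩ := b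
  obtain ⟨h1, h2, h3, m, h4⟩ := mem_region.1 h
  simp only at h1 h2 h3 h4
  obtain ⟨a, rfl | rfl⟩ := Int.even_or_odd' x
  · refine Or.inl ⟨a.toNat, (m - a).toNat, by omega, ?_⟩
    ext <;> simp <;> omega
  · refine Or.inr ⟨a.toNat, (m - a - 1).toNat, by omega, ?_⟩
    ext <;> simp <;> omega

theorem even_box_mem_oddTile {r i k a s : ℕ} :
    ((2 * (a : ℤ) + 1, 2 * (s : ℤ) + 2) : Box) ∈ (oddTile r i k).boxes ↔
      i ≤ a ∧ a < i + k ∧ s = r := by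
  rw [mem_oddTile]
  simp only [Prod.mk.injEq]
  constructor
  · rintro (⟨a', h⟩ | ⟨a', h⟩) <;> omega
  · rintro ⟨h1, h2, rfl⟩
    exact Or.inr ⟨a, h1, h2, rfl, rfl⟩

theorem odd_box_mem_oddTile {r i k a s : ℕ} :
    ((2 * (a : ℤ), 2 * (s : ℤ) + 1) : Box) ∈ (oddTile r i k).boxes ↔
      i ≤ a ∧ a ≤ i + k ∧ s = r := by
  rw [mem_oddTile]
  simp only [Prod.mk.injEq]
  constructor
  · rintro (⟨a', h⟩ | ⟨a', h⟩) <;> omega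
  · rintro ⟨h1, h2, rfl⟩
    exact Or.inl ⟨a, h1, h2, rfl, rfl⟩

theorem even_box_mem_evenTile {r a b s : ℕ} :
    ((2 * (a : ℤ) + 1, 2 * (s : ℤ) + 2) : Box) ∈ (evenTile r b).boxes ↔ a = b ∧ s = r := by
  rw [mem_evenTile]
  simp only [Prod.mk.injEq]
  omega

theorem odd_box_notMem_evenTile {r a b s : ℕ} :
    ((2 * (a : ℤ), 2 * (s : ℤ) + 1) : Box) ∉ (evenTile r b).boxes := by
  rw [mem_evenTile]
  simp only [Prod.mk.injEq]
  omega

theorem existsUnique_mem_codeTiles {n : ℕ} {c : ℕ → ℕ} (hc : IsCode n c) {b : Box}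
    (hb : b ∈ region n) : ∃! d, d ∈ codeTiles n c ∧ b ∈ d.boxes := by
  rcases exists_coords_of_mem_region hb with ⟨a, r, har, rfl⟩ | ⟨a, r, har, rfl⟩
  · obtain ⟨i, k, h, h1, h2⟩ := exists_isRun hc r a
    have h3 : i + k + r < n := by
      rcases k with - | k
      · omega
      · have := hc _ _ (h.2.1 (i + k) (by omega) (by omega))
        omega
    refine ⟨oddTile r i k, ⟨mem_codeTiles.2 (Or.inl ⟨r, i, k, h3, h, rfl⟩),
      odd_box_mem_oddTile.2 ⟨h1, h2, rfl⟩⟩, ?_⟩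
    rintro d ⟨hd, hbd⟩
    rcases mem_codeTiles.1 hd with ⟨r', i', k', -, h', rfl⟩ | ⟨r', b, -, -, rfl⟩
    · obtain ⟨h1', h2', rfl⟩ := odd_box_mem_oddTile.1 hbd
      obtain ⟨rfl, rfl⟩ := h.unique h' h1 h2 h1' h2'
      rfl
    · exact absurd hbd odd_box_notMem_evenTile
  · rcases le_or_gt (c a) r with hr | hr
    · refine ⟨evenTile r a, ⟨mem_codeTiles.2 (Or.inr ⟨r, a, har, hr, rfl⟩),
        even_box_mem_evenTile.2 ⟨rfl, rfl⟩⟩, ?_⟩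
      rintro d ⟨hd, hbd⟩
      rcases mem_codeTiles.1 hd with ⟨r', i', k', -, h', rfl⟩ | ⟨r', b, -, -, rfl⟩
      · obtain ⟨h1', h2', rfl⟩ := even_box_mem_oddTile.1 hbd
        have := h'.2.1 a h1' h2'
        omega
      · obtain ⟨rfl, rfl⟩ := even_box_mem_evenTile.1 hbd
        rfl
    · obtain ⟨i, k, h, h1, h2⟩ := exists_isRun hc r a
      have h2 : a < i + k := by
        rcases h2.lt_or_eq with h2 | rfl
        · exact h2
        · exact absurd h.2.2 (by omega)
      have h3 : i + k + r < n := by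
        rcases k with - | k
        · omega
        · have := hc _ _ (h.2.1 (i + k) (by omega) (by omega))
          omega
      refine ⟨oddTile r i k, ⟨mem_codeTiles.2 (Or.inl ⟨r, i, k, h3, h, rfl⟩),
        even_box_mem_oddTile.2 ⟨h1, h2, rfl⟩⟩, ?_⟩
      rintro d ⟨hd, hbd⟩
      rcases mem_codeTiles.1 hd with ⟨r', i', k', -, h', rfl⟩ | ⟨r', b, -, h5, rfl⟩
      · obtain ⟨h1', h2', rfl⟩ := even_box_mem_oddTile.1 hbd
        obtain ⟨rfl, rfl⟩ := h.unique h' h1 h2.le h1' h2'.le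
        rfl
      · obtain ⟨rfl, rfl⟩ := even_box_mem_evenTile.1 hbd
        omega

/-- The tiling with code `c`. -/
noncomputable def codeTiling (n : ℕ) (c : ℕ → ℕ) (hc : IsCode n c) : DyckTiling n where
  tiles := codeTiles n c
  subset_region := by
    rintro d hd b hb
    rcases mem_codeTiles.1 hd with ⟨r, i, k, h, -, rfl⟩ | ⟨r, a, h, -, rfl⟩
    · rcases mem_oddTile.1 hb with ⟨a, h1, h2, rfl⟩ | ⟨a, h1, h2, rfl⟩
      · exact mem_region.2 ⟨by positivity, by simp, by simp only; omega, a + r, by simp only; ring⟩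
      · exact mem_region.2 ⟨by positivity, by simp only; omega, by simp only; omega,
          a + r + 1, by simp only; ring⟩
    · obtain rfl := mem_evenTile.1 hb
      exact mem_region.2 ⟨by positivity, by simp only; omega, by simp only; omega,
        a + r + 1, by simp only; ring⟩
  tiling := fun b hb => existsUnique_mem_codeTiles hc hb
  cover_inclusive := by
    intro d hd
    rcases mem_codeTiles.1 hd with ⟨r, i, k, h, hrun, rfl⟩ | ⟨r, a, h, -, rfl⟩
    · rcases r with - | r
      · refine Or.inr fun b hb => ?_
        rw [mem_moveDown, mem_oddTile] at hb
        simp only [Prod.mk.injEq] at hb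
        change b.2 ≤ 0
        rcases hb with ⟨a, h⟩ | ⟨a, h⟩ <;> omega
      · left
        obtain ⟨i', k', hrun', h1, h2⟩ := exists_isRun hc r i
        -- The links of row `r + 1` are among those of row `r`, so a run of the upper row lies
        -- inside one of the lower row.
        have h3 : i + k ≤ i' + k' := by
          by_contra h3
          have := hrun.2.1 (i' + k') h2 (by omega)
          have := hrun'.2.2
          omega
        refine ⟨oddTile r i' k', mem_codeTiles.2 (Or.inl ⟨r, i', k', ?_, hrun', rfl⟩), ?_⟩
        · rcases k' with - | k'
          · omega
          · have := hc _ _ (hrun'.2.1 (i' + k') (by omega) (by omega))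
            omega
        · intro b hb
          obtain ⟨x, y⟩ := b
          rw [mem_moveDown, mem_oddTile] at hb
          rw [mem_oddTile]
          simp only [Prod.mk.injEq] at hb ⊢
          rcases hb with ⟨a, h⟩ | ⟨a, h⟩
          · exact Or.inl ⟨a, by omega⟩
          · exact Or.inr ⟨a, by omega⟩
    · rcases r with - | r
      · refine Or.inr fun b hb => ?_
        rw [mem_moveDown, mem_evenTile] at hb
        simp only [Prod.mk.injEq] at hb
        change b.2 ≤ 0
        omega
      · left
        have hreg : ((2 * (a : ℤ) + 1, 2 * (r : ℤ) + 2) : Box) ∈ region n :=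
          mem_region.2 ⟨by positivity, by simp only; omega, by simp only; omega,
            a + r + 1, by simp only; ring⟩
        obtain ⟨d, ⟨hd, hbd⟩, -⟩ := existsUnique_mem_codeTiles hc hreg
        refine ⟨d, hd, fun b hb => ?_⟩
        rw [mem_moveDown, mem_evenTile] at hb
        obtain rfl : b = (2 * (a : ℤ) + 1, 2 * (r : ℤ) + 2) := by
          simp only [Prod.mk.injEq] at hb
          ext <;> push_cast at hb ⊢ <;> omega
        exact hbd

theorem codeTiling_tiles {n : ℕ} {c : ℕ → ℕ} (hc : IsCode n c) :
    (codeTiling n c hc).tiles = codeTiles n c := rfl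

/-- Double counting: the pairs `(b, r)` with `r < c b` index the even-height boxes covered by odd
tiles. A zigzag of size `k` contains exactly `k` of them, and a single box at even height contains
none. -/
theorem codeTiling_weight {n : ℕ} {c : ℕ → ℕ} (hc : IsCode n c) :
    (codeTiling n c hc).weight = ∑ b ∈ Finset.range n, c b := by
  classical
  let L : Finset (Σ _ : ℕ, ℕ) := (Finset.range n).sigma fun b => Finset.range (c b)
  have hL : ∀ b r, (⟨b, r⟩ : Σ _ : ℕ, ℕ) ∈ L ↔ r < c b := by
    intro b r
    simp only [L, Finset.mem_sigma, Finset.mem_range, and_iff_right_iff_imp]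
    intro h
    have := hc b r h
    omega
  let R : DyckTile → (Σ _ : ℕ, ℕ) → Prop := fun d p =>
    ((2 * (p.1 : ℤ) + 1, 2 * (p.2 : ℤ) + 2) : Box) ∈ d.boxes
  have h1 := Finset.sum_card_bipartiteAbove_eq_sum_card_bipartiteBelow (s := codeTiles n c)
    (t := L) R
  have h2 : ∀ d ∈ codeTiles n c, (Finset.bipartiteAbove R L d).card = d.size := by
    intro d hd
    rcases mem_codeTiles.1 hd with ⟨r, i, k, h, hrun, rfl⟩ | ⟨r, a, h, hr, rfl⟩
    · have : Finset.bipartiteAbove R L (oddTile r i k)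
          = (Finset.Ico i (i + k)).image fun b => (⟨b, r⟩ : Σ _ : ℕ, ℕ) := by
        ext ⟨b, s⟩
        simp only [Finset.mem_bipartiteAbove, hL, R, even_box_mem_oddTile, Finset.mem_image,
          Finset.mem_Ico, Sigma.mk.injEq, heq_eq_eq]
        constructor
        · rintro ⟨-, h1, h2, rfl⟩
          exact ⟨b, ⟨h1, h2⟩, rfl, rfl⟩
        · rintro ⟨b, ⟨h1, h2⟩, rfl, rfl⟩
          exact ⟨hrun.2.1 _ h1 h2, h1, h2, rfl⟩
      rw [this, Finset.card_image_of_injective _ (fun x y h => by simpa using h)]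
      simp [oddTile]
    · have : Finset.bipartiteAbove R L (evenTile r a) = ∅ := by
        ext ⟨b, s⟩
        simp only [Finset.mem_bipartiteAbove, hL, R, even_box_mem_evenTile,
          Finset.notMem_empty, iff_false, not_and]
        rintro h1 rfl rfl
        omega
      rw [this]
      simp [evenTile]
  have h3 : ∀ p ∈ L, (Finset.bipartiteBelow R (codeTiles n c) p).card = 1 := by
    rintro ⟨b, r⟩ hp
    have := hc b r ((hL b r).1 hp)
    have hreg : ((2 * (b : ℤ) + 1, 2 * (r : ℤ) + 2) : Box) ∈ region n :=
      mem_region.2 ⟨by positivity, by simp only; omega, by simp only; omega,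
        b + r + 1, by simp only; ring⟩
    obtain ⟨d, hd, hu⟩ := existsUnique_mem_codeTiles hc hreg
    rw [Finset.card_eq_one]
    refine ⟨d, Finset.ext fun e => ?_⟩
    rw [Finset.mem_bipartiteBelow, Finset.mem_singleton]
    exact ⟨fun h => hu e h, fun h => h ▸ hd⟩
  rw [Finset.sum_congr rfl h2, Finset.sum_congr rfl h3] at h1
  rw [DyckTiling.weight, codeTiling_tiles, h1]
  simp [L]

/-! ### Every tiling comes from its code -/

namespace DyckTiling

variable {n : ℕ}

theorem eq_of_mem_boxes (T : DyckTiling n) {d d' : DyckTile} {b : Box} (hd : d ∈ T.tiles)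
    (hd' : d' ∈ T.tiles) (h : b ∈ d.boxes) (h' : b ∈ d'.boxes) : d = d' :=
  (T.tiling b (T.subset_region d hd h)).unique ⟨hd, h⟩ ⟨hd', h'⟩

/-- The boxes of a tile have at most two heights, and only one if the tile starts at an even
height. -/
theorem height_le (T : DyckTiling n) {d : DyckTile} (hd : d ∈ T.tiles) :
    (∀ b ∈ d.boxes, b.2 ≤ d.start.2 + 1) ∧ (Even d.start.2 → ∀ b ∈ d.boxes, b.2 ≤ d.start.2) := by
  induction hm : d.start.2.toNat using Nat.strong_induction_on generalizing d with
  | _ m ih =>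
  have hs := (mem_region.1 (T.subset_region d hd d.start_mem_boxes)).2.1
  have hdown : ∀ b ∈ d.boxes, (b.1, b.2 - 2) ∈ moveDown d.boxes := fun b hb => by
    rw [mem_moveDown]
    simpa using hb
  rcases T.cover_inclusive d hd with ⟨d', hd', hsub⟩ | hsub
  · have h1 := (DyckTile.start_le_of_mem_boxes (hsub (hdown _ d.start_mem_boxes))).2
    have hs' := (mem_region.1 (T.subset_region d' hd' d'.start_mem_boxes)).2.1
    simp only at h1
    obtain ⟨h2, h3⟩ := ih _ (by omega) hd' rfl
    have h4 := h2 _ (hsub (hdown _ d.start_mem_boxes))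
    simp only at h4
    rw [Int.even_iff] at h3 ⊢
    -- All of `d` lies two above boxes of `d'`. If `d` starts at even height, then either `d'` also
    -- does and is flat, or `d` starts above the top row of `d'`; in both cases `d` is flat.
    have h5 : ∀ b ∈ d.boxes, b.2 ≤ d'.start.2 + 3 ∧
        (d'.start.2 % 2 = 0 → b.2 ≤ d'.start.2 + 2) := fun b hb => by
      have h6 := h2 _ (hsub (hdown b hb))
      have h7 := fun h => h3 h _ (hsub (hdown b hb))
      simp only at h6 h7
      exact ⟨by omega, fun h => by have := h7 h; omega⟩
    refine ⟨fun b hb => ?_, fun he b hb => ?_⟩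
    · have := h5 b hb
      omega
    · have := h5 b hb
      by_cases h8 : d'.start.2 % 2 = 0
      · have := this.2 h8
        omega
      · omega
  · have h1 : ∀ b ∈ d.boxes, b.2 - 2 ≤ 0 := fun b hb => hsub (hdown b hb)
    refine ⟨fun b hb => ?_, fun he b hb => ?_⟩
    · have := h1 b hb
      omega
    · have := h1 b hb
      rw [Int.even_iff] at he
      omega

theorem eq_oddTile_or_eq_evenTile (T : DyckTiling n) {d : DyckTile} (hd : d ∈ T.tiles) :
    (∃ r i k, i + k + r < n ∧ d = oddTile r i k) ∨ (∃ r b, b + r + 1 < n ∧ d = evenTile r b) := by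
  obtain ⟨h1, h2⟩ := T.height_le hd
  obtain ⟨k, hk⟩ := d.exists_eq_zigzag h1
  rcases exists_coords_of_mem_region (T.subset_region d hd d.start_mem_boxes) with
    ⟨i, r, h, hs⟩ | ⟨i, r, h, hs⟩
  · left
    rw [hs] at hk
    change d = oddTile r i k at hk
    refine ⟨r, i, k, ?_, hk⟩
    have h3 : ((2 * ((i + k : ℕ) : ℤ), 2 * (r : ℤ) + 1) : Box) ∈ d.boxes := by
      rw [hk, odd_box_mem_oddTile]
      omega
    have := (mem_region.1 (T.subset_region d hd h3)).2.2.1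
    simp only at this
    push_cast at this
    omega
  · right
    refine ⟨r, i, h, ?_⟩
    have h3 := h2 (by rw [hs, Int.even_iff]; simp only; omega)
    rcases k with - | k
    · rw [hk, hs]
      rfl
    -- The second box of a nontrivial zigzag is one higher than the first, which a tile starting at
    -- even height does not allow.
    · have h4 : (d.start.1 + ((1 : ℕ) : ℤ), d.start.2 + ((1 % 2 : ℕ) : ℤ)) ∈ d.boxes := by
        have : (d.start.1 + ((1 : ℕ) : ℤ), d.start.2 + ((1 % 2 : ℕ) : ℤ)) ∈
            (DyckTile.zigzag d.start (k + 1)).boxes := DyckTile.mem_zigzag_boxes.2 ⟨1, by omega, rfl⟩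
        rwa [← hk] at this
      have := h3 _ h4
      simp at this

/-- Two consecutive boxes in an odd row belong to the same tile. -/
def Linked (T : DyckTiling n) (r b : ℕ) : Prop :=
  ∃ d ∈ T.tiles, ((2 * (b : ℤ), 2 * (r : ℤ) + 1) : Box) ∈ d.boxes ∧
    ((2 * ((b + 1 : ℕ) : ℤ), 2 * (r : ℤ) + 1) : Box) ∈ d.boxes

theorem Linked.lt {T : DyckTiling n} {r b : ℕ} (h : T.Linked r b) : b + r + 1 < n := by
  obtain ⟨d, hd, -, h⟩ := h
  have := (mem_region.1 (T.subset_region d hd h)).2.2.1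
  simp only at this
  push_cast at this
  omega

/-- The tile joining the two boxes, moved down, lies in a single tile. It cannot lie below the
zigzag path, since row `r` has positive height. -/
theorem Linked.of_succ {T : DyckTiling n} {r b : ℕ} (h : T.Linked (r + 1) b) : T.Linked r b := by
  obtain ⟨d, hd, h1, h2⟩ := h
  have h1' : ((2 * (b : ℤ), 2 * (r : ℤ) + 1) : Box) ∈ moveDown d.boxes := by
    rw [mem_moveDown]
    convert h1 using 2
    push_cast
    ring
  have h2' : ((2 * ((b + 1 : ℕ) : ℤ), 2 * (r : ℤ) + 1) : Box) ∈ moveDown d.boxes := by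
    rw [mem_moveDown]
    convert h2 using 2
    push_cast
    ring
  rcases T.cover_inclusive d hd with ⟨d', hd', hsub⟩ | hsub
  · exact ⟨d', hd', hsub h1', hsub h2'⟩
  · have : 2 * (r : ℤ) + 1 ≤ 0 := hsub h1'
    omega

theorem Linked.of_le {T : DyckTiling n} {r s b : ℕ} (h : T.Linked r b) (hs : s ≤ r) :
    T.Linked s b := by
  induction r with
  | zero => rwa [Nat.le_zero.1 hs]
  | succ r ih =>
    rcases hs.lt_or_eq with hs | rfl
    · exact ih h.of_succ (by omega)
    · exact h

theorem exists_not_linked (T : DyckTiling n) (b : ℕ) : ∃ r, ¬ T.Linked r b :=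
  ⟨n, fun h => by have := h.lt; omega⟩

open Classical in
/-- The code of a tiling: the number of rows in which there is a link at a given column. -/
noncomputable def code (T : DyckTiling n) (b : ℕ) : ℕ := Nat.find (T.exists_not_linked b)

theorem lt_code {T : DyckTiling n} {r b : ℕ} : r < T.code b ↔ T.Linked r b := by
  classical
  rw [code, Nat.lt_find_iff]
  simp only [not_not]
  exact ⟨fun h => h r le_rfl, fun h m hm => h.of_le hm⟩

theorem isCode_code (T : DyckTiling n) : IsCode n T.code := fun _ _ h => (lt_code.1 h).lt

theorem tiles_subset_codeTiles (T : DyckTiling n) : T.tiles ⊆ codeTiles n T.code := by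
  intro d hd
  rw [mem_codeTiles]
  rcases T.eq_oddTile_or_eq_evenTile hd with ⟨r, i, k, h, rfl⟩ | ⟨r, b, h, rfl⟩
  · refine Or.inl ⟨r, i, k, h, ⟨fun b hb => ?_, fun b hb hb' => ?_, ?_⟩, rfl⟩
    · subst hb
      by_contra h1
      obtain ⟨d', hd', h2, h3⟩ := lt_code.1 (not_le.1 h1)
      rw [T.eq_of_mem_boxes hd' hd h3 (odd_box_mem_oddTile.2 ⟨le_rfl, by omega, rfl⟩),
        odd_box_mem_oddTile] at h2
      omega
    · exact lt_code.2 ⟨_, hd, odd_box_mem_oddTile.2 (by omega), odd_box_mem_oddTile.2 (by omega)⟩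
    · by_contra h1
      obtain ⟨d', hd', h2, h3⟩ := lt_code.1 (not_le.1 h1)
      rw [T.eq_of_mem_boxes hd' hd h2 (odd_box_mem_oddTile.2 ⟨by omega, le_rfl, rfl⟩),
        odd_box_mem_oddTile] at h3
      omega
  · refine Or.inr ⟨r, b, h, ?_, rfl⟩
    by_contra h1
    obtain ⟨d', hd', h2, h3⟩ := lt_code.1 (not_le.1 h1)
    rcases T.eq_oddTile_or_eq_evenTile hd' with ⟨r', i, k, h, rfl⟩ | ⟨r', b, h, rfl⟩
    · rw [odd_box_mem_oddTile] at h2 h3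
      have h4 := T.eq_of_mem_boxes hd hd' (even_box_mem_evenTile.2 ⟨rfl, rfl⟩)
        (even_box_mem_oddTile.2 (by omega))
      rw [← h2.2.2] at *
      have h5 := odd_box_mem_oddTile.2 h2
      rw [← h4] at h5
      exact odd_box_notMem_evenTile h5
    · exact odd_box_notMem_evenTile h2

/-- The tiles of `T` already cover the region, which leaves no box for a further tile of `T'`. -/
theorem eq_of_tiles_subset {T T' : DyckTiling n} (h : T.tiles ⊆ T'.tiles) : T = T' := by
  refine DyckTiling.ext (Finset.Subset.antisymm h fun d hd => ?_)
  obtain ⟨d', ⟨hd', h1⟩, -⟩ := T.tiling d.start (T'.subset_region d hd d.start_mem_boxes)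
  rwa [T'.eq_of_mem_boxes hd (h hd') d.start_mem_boxes h1]

theorem eq_codeTiling (T : DyckTiling n) : T = codeTiling n T.code T.isCode_code :=
  eq_of_tiles_subset T.tiles_subset_codeTiles

/-! ### Trajectories and their determinism -/

theorem eq_of_entry_eq (T : DyckTiling n) {d d' : DyckTile} (hd : d ∈ T.tiles)
    (hd' : d' ∈ T.tiles) (h : d.entry = d'.entry) : d = d' := by
  have : d.start = d'.start := by
    simp only [DyckTile.entry, Prod.mk.injEq] at h
    ext <;> omega
  exact T.eq_of_mem_boxes hd hd' d.start_mem_boxes (this ▸ d'.start_mem_boxes)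

/-- Each tile has at most one successor, so of two chains from the same anchor one extends the
other; a terminal tile admits no extension. -/
theorem TrajectoryEndsAt.unique {T : DyckTiling n} {i : Fin n} {u u' : UpStep}
    (h : T.TrajectoryEndsAt i u) (h' : T.TrajectoryEndsAt i u') : u = u' := by
  obtain ⟨d₀, h₀, d, hd, h1, h2, h3, rfl⟩ := h
  obtain ⟨d₀', h₀', d', hd', h1', h2', h3', rfl⟩ := h'
  obtain rfl : d₀ = d₀' := T.eq_of_mem_boxes h₀ h₀' d₀.start_mem_boxes
    (by rw [h1, ← h1']; exact d₀'.start_mem_boxes)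
  have key : ∀ {d d' : DyckTile}, (∀ e ∈ T.tiles, d.exit ≠ e.entry) →
      Relation.ReflTransGen (fun e e' => e' ∈ T.tiles ∧ e.exit = e'.entry) d d' → d = d' := by
    intro d d' h3 h
    rcases h.cases_head with h | ⟨e, ⟨he, h⟩, -⟩
    · exact h
    · exact absurd h (h3 e he)
  rcases Relation.ReflTransGen.total_of_right_unique
    (fun a b c hb hc => T.eq_of_entry_eq hb.1 hc.1 (hb.2.symm.trans hc.2)) h2 h2' with h | h
  · rw [key h3 h]
  · rw [key h3' h]

theorem Corresponds.unique {T : DyckTiling n} {w w' : Equiv.Perm (Fin n)}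
    (h : T.Corresponds w) (h' : T.Corresponds w') : w = w' := by
  refine Equiv.ext fun j => ?_
  obtain ⟨u, hu, hu1⟩ := h j
  obtain ⟨u', hu', hu1'⟩ := h' (w'.symm (w j))
  rw [w'.apply_symm_apply] at hu'
  obtain rfl := hu.unique hu'
  have h1 : peakX n j = peakX n (w'.symm (w j)) := hu1.symm.trans hu1'
  have h2 : j = w'.symm (w j) := by
    simp only [peakX] at h1
    exact Fin.ext (by omega)
  exact ((Equiv.eq_symm_apply _).1 h2).symm

end DyckTiling

theorem oddTile_exit (r i k : ℕ) :
    (oddTile r i k).exit = (2 * ((i + k : ℕ) : ℤ), 2 * (r : ℤ)) := by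
  rw [oddTile, DyckTile.zigzag_exit]
  ext <;> push_cast <;> ring

theorem oddTile_entry (r i k : ℕ) :
    (oddTile r i k).entry = (2 * (i : ℤ) - 1, 2 * (r : ℤ) + 1) := rfl

theorem evenTile_exit (r b : ℕ) :
    (evenTile r b).exit = (2 * (b : ℤ) + 1, 2 * (r : ℤ) + 1) := by
  rw [evenTile, DyckTile.zigzag_exit]
  ext <;> push_cast <;> ring

theorem evenTile_entry (r b : ℕ) :
    (evenTile r b).entry = (2 * (b : ℤ), 2 * (r : ℤ) + 2) := by
  rw [evenTile, DyckTile.zigzag_entry]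
  ext <;> simp

theorem exists_isRun_of_start {n : ℕ} {c : ℕ → ℕ} (hc : IsCode n c) {r i : ℕ}
    (h : ∀ b, b + 1 = i → c b ≤ r) : ∃ k, IsRun c r i k := by
  obtain ⟨i', k, h1, h2, h3⟩ := exists_isRun hc r i
  obtain rfl : i' = i := by
    by_contra hne
    have := h (i - 1) (by omega)
    have := h1.2.1 (i - 1) (by omega) (by omega)
    omega
  exact ⟨k, h1⟩

/-- A trajectory in the tiling with code `c` which is to end in column `t`; here `ρ b` is the row
in which it passes column `b`. -/
theorem exists_trajectory {n : ℕ} {c : ℕ → ℕ} (hc : IsCode n c) {ρ : ℕ → ℕ} {t : ℕ}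
    (hρ : ∀ b < t, (ρ b < c b ∧ ρ (b + 1) = ρ b) ∨ (c b ≤ ρ (b + 1) ∧ ρ b = ρ (b + 1) + 1))
    (ht : c t = ρ t) (htn : t + ρ t < n) {i : ℕ} (hi : i ≤ t) (h0 : ∀ b, b + 1 = i → c b ≤ ρ i) :
    ∃ k, ∃ d ∈ codeTiles n c, oddTile (ρ i) i k ∈ codeTiles n c ∧
      Relation.ReflTransGen (fun e e' => e' ∈ codeTiles n c ∧ e.exit = e'.entry)
        (oddTile (ρ i) i k) d ∧
      (∀ d' ∈ codeTiles n c, d.exit ≠ d'.entry) ∧ d.exit = (2 * (t : ℤ), 2 * (ρ t : ℤ)) := by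
  -- Going back from `t`, the row rises by at most one per column, so the path stays in the region.
  have hbound : ∀ m b, b + m = t → b + ρ b < n := by
    intro m
    induction m with
    | zero => rintro b rfl
              exact htn
    | succ m ih =>
      intro b hb
      have := ih (b + 1) (by omega)
      rcases hρ b (by omega) with h | h <;> omega
  induction hm : t - i using Nat.strong_induction_on generalizing i with
  | _ m ih =>
  obtain ⟨k, hk⟩ := exists_isRun_of_start hc h0
  have hconst : ∀ m ≤ k, i + m ≤ t → ρ (i + m) = ρ i := by
    intro m
    induction m with
    | zero => intros; rfl
    | succ m ihm =>
      intro h1 h2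
      have h3 := ihm (by omega) (by omega)
      have h4 := hk.2.1 (i + m) (by omega) (by omega)
      rcases hρ (i + m) (by omega) with h | h
      · rw [← add_assoc, h.2, h3]
      · omega
  -- A run extending past `t` would give `ρ t < c t`.
  have hkt : i + k ≤ t := by
    by_contra hkt
    have h1 := hk.2.1 t hi (by omega)
    have h2 := hconst (t - i) (by omega) (by omega)
    rw [Nat.add_sub_cancel' hi] at h2
    omega
  have hrow := hconst k le_rfl hkt
  have hmem : oddTile (ρ i) i k ∈ codeTiles n c := by
    refine mem_codeTiles.2 (Or.inl ⟨_, _, _, ?_, hk, rfl⟩)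
    have := hbound (t - (i + k)) (i + k) (by omega)
    omega
  rcases hkt.lt_or_eq with hlt | rfl
  · have hle := hk.2.2
    rw [← hrow] at hle
    obtain ⟨h1, h2⟩ : c (i + k) ≤ ρ (i + k + 1) ∧ ρ (i + k) = ρ (i + k + 1) + 1 := by
      rcases hρ (i + k) hlt with h | h
      · omega
      · exact h
    obtain ⟨k', d, hd, h3, h4, h5, h6⟩ := ih (t - (i + k + 1)) (by omega) (i := i + k + 1)
      (by omega) (fun b hb => by obtain rfl : b = i + k := by omega
                                 exact h1) rfl
    have heven : evenTile (ρ (i + k + 1)) (i + k) ∈ codeTiles n c := by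
      refine mem_codeTiles.2 (Or.inr ⟨_, _, ?_, h1, rfl⟩)
      have := hbound (t - (i + k)) (i + k) (by omega)
      omega
    -- The trajectory crosses the zigzag of the current row, then one single box leading down a row,
    -- then continues by induction.
    refine ⟨k, d, hd, hmem, Relation.ReflTransGen.head ⟨heven, ?_⟩
      (Relation.ReflTransGen.head ⟨h3, ?_⟩ h4), h5, h6⟩
    · rw [oddTile_exit, evenTile_entry, ← hrow, h2]
      push_cast
      ring_nf
    · rw [evenTile_exit, oddTile_entry]
      push_cast
      ring_nf
  · refine ⟨k, _, hmem, hmem, Relation.ReflTransGen.refl, fun d' hd' h => ?_, ?_⟩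
    -- By parity only an even tile could follow. It would be the one in column `t` and row `ρ t -
    -- 1`, which is absent because `c t = ρ t`.
    · rw [oddTile_exit] at h
      rcases mem_codeTiles.1 hd' with ⟨r', i', k', -, -, rfl⟩ | ⟨r', b, -, h2, rfl⟩
      · rw [oddTile_entry] at h
        simp only [Prod.mk.injEq] at h
        omega
      · rw [evenTile_entry] at h
        simp only [Prod.mk.injEq] at h
        obtain rfl : i + k = b := by omega
        omega
    · rw [oddTile_exit, hrow]

/-! ### The tiling of a permutation -/

section Perm

variable {n : ℕ}

/-- The number of larger letters to the left of the `i`-th letter. -/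
def greaterBefore (w : Equiv.Perm (Fin n)) (i : Fin n) : ℕ :=
  (Finset.univ.filter fun j => j < i ∧ w i < w j).card

/-- The number of smaller letters to the left of the `i`-th letter. -/
def smallerBefore (w : Equiv.Perm (Fin n)) (i : Fin n) : ℕ :=
  (Finset.univ.filter fun j => j < i ∧ w j < w i).card

theorem greaterBefore_add_smallerBefore (w : Equiv.Perm (Fin n)) (i : Fin n) :
    greaterBefore w i + smallerBefore w i = i := by
  rw [greaterBefore, smallerBefore, ← Finset.card_union_of_disjoint]
  · rw [← Finset.filter_or]
    have : (Finset.univ.filter fun j => j < i ∧ w i < w j ∨ j < i ∧ w j < w i) = Finset.Iio i := by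
      ext j
      simp only [Finset.mem_filter, Finset.mem_univ, true_and, Finset.mem_Iio, ← and_or_left,
        and_iff_left_iff_imp]
      intro h
      exact lt_or_gt_of_ne fun h' => h.ne (w.injective h').symm
    rw [this, Fin.card_Iio]
  · rw [Finset.disjoint_filter]
    rintro j - ⟨-, h⟩ ⟨-, h'⟩
    exact lt_asymm h h'

theorem smallerBefore_le (w : Equiv.Perm (Fin n)) (i : Fin n) : smallerBefore w i ≤ i := by
  have := greaterBefore_add_smallerBefore w i
  omega

/-- The code of the tiling that corresponds to a permutation. -/
def permCode (w : Equiv.Perm (Fin n)) (b : ℕ) : ℕ :=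
  if h : b < n then greaterBefore w (Fin.rev ⟨b, h⟩) else 0

theorem permCode_rev (w : Equiv.Perm (Fin n)) (i : Fin n) :
    permCode w (Fin.rev i) = greaterBefore w i := by
  rw [permCode, dif_pos (Fin.rev i).2, Fin.eta, Fin.rev_rev]

theorem isCode_permCode (w : Equiv.Perm (Fin n)) : IsCode n (permCode w) := by
  intro b r h
  rw [permCode] at h
  split_ifs at h with hb
  · have := greaterBefore_add_smallerBefore w (Fin.rev ⟨b, hb⟩)
    rw [Fin.val_rev] at this
    simp only at this
    omega
  · omega

/-- The tiling that corresponds to a permutation. -/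
noncomputable def permTiling (w : Equiv.Perm (Fin n)) : DyckTiling n :=
  codeTiling n (permCode w) (isCode_permCode w)

theorem card_greater (w : Equiv.Perm (Fin n)) (j : Fin n) :
    (Finset.univ.filter fun k => w j < w k).card = n - 1 - w j := by
  rw [← Fin.card_Ioi]
  refine Finset.card_bij (fun k _ => w k) (by simp) (fun a _ b _ h => w.injective h) ?_
  intro b hb
  exact ⟨w.symm b, by simpa using hb, by simp⟩

/-- Columns run through the positions from right to left. In column `b` the trajectory of `w j` is
in the row given by the number of letters larger than `w j` among the first `n - b`. -/
theorem permTiling_corresponds (w : Equiv.Perm (Fin n)) : (permTiling w).Corresponds w := by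
  intro j
  let ρ : ℕ → ℕ := fun b => (Finset.univ.filter fun k : Fin n => (k : ℕ) + b < n ∧ w j < w k).card
  have hρ : ∀ b < (Fin.rev j : ℕ), (ρ b < permCode w b ∧ ρ (b + 1) = ρ b) ∨
      (permCode w b ≤ ρ (b + 1) ∧ ρ b = ρ (b + 1) + 1) := by
    intro b hb
    rw [Fin.val_rev] at hb
    have hbn : b < n := by omega
    obtain ⟨m, hm⟩ : ∃ m : Fin n, m = Fin.rev ⟨b, hbn⟩ := ⟨_, rfl⟩
    have hmv : (m : ℕ) + b + 1 = n := by
      rw [hm, Fin.val_rev]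
      simp only
      omega
    have hcode : permCode w b = greaterBefore w m := by rw [permCode, dif_pos hbn, hm]
    have hlt : ∀ k : Fin n, (k : ℕ) + (b + 1) < n ↔ k < m := fun k => by
      rw [Fin.lt_def]
      omega
    have hle : ∀ k : Fin n, (k : ℕ) + b < n ↔ k = m ∨ k < m := fun k => by
      rw [Fin.lt_def, Fin.ext_iff]
      omega
    rw [hcode]
    simp only [ρ, greaterBefore, hlt, hle]
    have hjm : j < m := by
      rw [Fin.lt_def]
      omega
    rcases lt_or_gt_of_ne (fun h => hjm.ne (w.injective h) : w j ≠ w m) with h | h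
    -- Passing a larger letter: it leaves the count, so the row drops by one.
    · right
      constructor
      · exact Finset.card_le_card (Finset.monotone_filter_right _
          fun k _ hk => ⟨hk.1, h.trans hk.2⟩)
      · have : (Finset.univ.filter fun k => (k = m ∨ k < m) ∧ w j < w k)
            = insert m (Finset.univ.filter fun k => k < m ∧ w j < w k) := by
          ext k
          simp only [Finset.mem_filter, Finset.mem_univ, true_and, Finset.mem_insert]
          constructor
          · rintro ⟨h1 | h1, h2⟩
            · exact Or.inl h1
            · exact Or.inr ⟨h1, h2⟩
          · rintro (rfl | ⟨h1, h2⟩)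
            · exact ⟨Or.inl rfl, h⟩
            · exact ⟨Or.inr h1, h2⟩
        rw [this, Finset.card_insert_of_notMem (by simp)]
    -- Passing a smaller letter: the row is kept. The code is strictly larger because it also counts
    -- `j` itself.
    · left
      have heq : (Finset.univ.filter fun k => (k = m ∨ k < m) ∧ w j < w k)
          = Finset.univ.filter fun k => k < m ∧ w j < w k := by
        refine Finset.filter_congr fun k _ => and_congr_left fun hk => or_iff_right ?_
        rintro rfl
        exact lt_asymm hk h
      rw [heq]
      refine ⟨Finset.card_lt_card ?_, rfl⟩
      rw [Finset.ssubset_iff_of_subset (Finset.monotone_filter_right _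
        fun k _ hk => ⟨hk.1, h.trans hk.2⟩)]
      exact ⟨j, by simpa using ⟨hjm, h⟩, by simp⟩
  have ht : permCode w (Fin.rev j) = ρ (Fin.rev j) := by
    rw [permCode_rev, greaterBefore]
    refine congrArg Finset.card (Finset.filter_congr fun k _ => and_congr_left fun hk => ?_)
    have : k ≠ j := by
      rintro rfl
      exact lt_irrefl _ hk
    rw [Fin.val_rev, Fin.lt_def]
    rw [Ne, Fin.ext_iff] at this
    omega
  have htn : (Fin.rev j : ℕ) + ρ (Fin.rev j) < n := by
    rw [← ht, permCode_rev]
    have := greaterBefore_add_smallerBefore w j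
    rw [Fin.val_rev]
    omega
  have h0 : ρ 0 = n - 1 - w j := by
    rw [← card_greater]
    simp only [ρ, add_zero, Fin.is_lt, true_and]
  obtain ⟨k, d, hd, h1, h2, h3, h4⟩ := exists_trajectory (isCode_permCode w) hρ ht htn
    (Nat.zero_le _) (by omega)
  refine ⟨d.exit, ⟨_, h1, d, hd, ?_, h2, h3, rfl⟩, ?_⟩
  · rw [h0]
    simp only [oddTile, DyckTile.zigzag_start, DyckTiling.anchorBox]
    have := (w j).2
    ext
    · simp
    · simp only
      omega
  · rw [h4, DyckTiling.peakX]
    simp only [Fin.val_rev]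
    omega

theorem permCode_congr {w w' : Equiv.Perm (Fin n)} (h : smallerBefore w = smallerBefore w') :
    permCode w = permCode w' := by
  funext b
  rw [permCode, permCode]
  split_ifs with hb
  · have h1 := greaterBefore_add_smallerBefore w (Fin.rev ⟨b, hb⟩)
    have h2 := greaterBefore_add_smallerBefore w' (Fin.rev ⟨b, hb⟩)
    rw [h] at h1
    omega
  · rfl

/-- The tiling depends only on these counts, and the permutation can be read off from its
trajectories. -/
theorem smallerBefore_injective :
    Function.Injective (smallerBefore : Equiv.Perm (Fin n) → Fin n → ℕ) := by
  intro w w' h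
  have : permTiling w = permTiling w' := by simp only [permTiling, permCode_congr h]
  exact (permTiling_corresponds w).unique (this ▸ permTiling_corresponds w')

end Perm

/-! ### The `q`-Catalan numbers count weakly increasing sequences by their sum -/

open Polynomial in
/-- The sum of `q ^ (e 0 + ⋯ + e (m - 1))` over the weakly increasing sequences `e` with `e i ≤ i`
and `e i ≤ x`, defined by recursion on the last term. -/
noncomputable def boundedSum : ℕ → ℕ → ℤ[X]
  | 0, _ => 1
  | m + 1, x => ∑ a ∈ (Finset.range (m + 1)).filter (· ≤ x), X ^ a * boundedSum m a

theorem coeff_succ_qPochhammer_succ (M j : ℕ) :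
    PowerSeries.coeff (j + 1) (qPochhammer (M + 1)) =
      PowerSeries.coeff (j + 1) (qPochhammer M)
        - (Polynomial.X : ℤ[X]) ^ M * PowerSeries.coeff j (qPochhammer M) := by
  rw [qPochhammer, Finset.prod_range_succ, ← qPochhammer, mul_sub, mul_one, map_sub,
    ← mul_assoc, PowerSeries.coeff_succ_mul_X, mul_comm, PowerSeries.coeff_C_mul]

theorem coeff_succ_qPochhammer_zero (j : ℕ) :
    PowerSeries.coeff (j + 1) (qPochhammer 0) = 0 := by
  simp [qPochhammer, PowerSeries.coeff_one]

theorem boundedSum_succ_succ (m x : ℕ) : boundedSum (m + 1) (x + 1) =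
    boundedSum (m + 1) x +
      if x < m then (Polynomial.X : ℤ[X]) ^ (x + 1) * boundedSum m (x + 1) else 0 := by
  simp only [boundedSum]
  split_ifs with h
  · have : (Finset.range (m + 1)).filter (· ≤ x + 1)
        = insert (x + 1) ((Finset.range (m + 1)).filter (· ≤ x)) := by
      ext a
      simp only [Finset.mem_filter, Finset.mem_range, Finset.mem_insert]
      omega
    rw [this, Finset.sum_insert (by simp), add_comm]
  · rw [add_zero]
    refine Finset.sum_congr (Finset.ext fun a => ?_) fun _ _ => rfl
    simp only [Finset.mem_filter, Finset.mem_range]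
    omega

/-- Summation by parts in `K`: raising `K` changes `boundedSum` by its new top term, which gives the
second sum, and multiplies the product by one more factor, which gives the first. -/
theorem boundedSum_mul_coeff (m j K : ℕ) :
    boundedSum (m + 1) K * PowerSeries.coeff (j + 1) (qPochhammer (K + 1)) =
      - (∑ b ∈ Finset.range (K + 1), (Polynomial.X : ℤ[X]) ^ b * boundedSum (m + 1) b
          * PowerSeries.coeff j (qPochhammer b))
      + ∑ a ∈ (Finset.range (K + 1)).filter (· < m + 1), (Polynomial.X : ℤ[X]) ^ a
          * boundedSum m a * PowerSeries.coeff (j + 1) (qPochhammer a) := by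
  induction K with
  | zero =>
    rw [coeff_succ_qPochhammer_succ, coeff_succ_qPochhammer_zero]
    have : (Finset.range (0 + 1)).filter (· < m + 1) = {0} := by
      ext a
      simp only [Finset.mem_filter, Finset.mem_range, Finset.mem_singleton]
      omega
    rw [this, Finset.sum_singleton, coeff_succ_qPochhammer_zero]
    simp
  | succ K ih =>
    rw [coeff_succ_qPochhammer_succ, Finset.sum_range_succ, Finset.range_add_one (n := K + 1),
      Finset.filter_insert, boundedSum_succ_succ m K, mul_sub, add_mul, ih]
    by_cases h : K < m
    · rw [if_pos h, if_pos (by omega), Finset.sum_insert (by simp)]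
      ring
    · rw [if_neg h, if_neg (by omega)]
      ring

theorem boundedSum_zero_mul_coeff (j : ℕ) (K : ℕ) :
    boundedSum 0 K * PowerSeries.coeff (j + 1) (qPochhammer (K + 1)) =
      - (∑ b ∈ Finset.range (K + 1), (Polynomial.X : ℤ[X]) ^ b * boundedSum 0 b
          * PowerSeries.coeff j (qPochhammer b)) := by
  simp only [boundedSum, one_mul, mul_one]
  induction K with
  | zero => simp [coeff_succ_qPochhammer_succ, coeff_succ_qPochhammer_zero]
  | succ K ih =>
    rw [coeff_succ_qPochhammer_succ, Finset.sum_range_succ, ih]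
    ring

/-- The sum telescopes: in `boundedSum_mul_coeff` the second sum cancels the remainder left at stage
`k`, and the first sum is the remainder at stage `k + 1`. -/
theorem sum_boundedSum_mul_coeff (m k : ℕ) (hk : k ≤ m) :
    ∑ i ∈ Finset.range (k + 1), boundedSum i i
        * PowerSeries.coeff (m + 1 - i) (qPochhammer (i + 1)) =
      - ∑ b ∈ Finset.range (k + 1), (Polynomial.X : ℤ[X]) ^ b * boundedSum k b
          * PowerSeries.coeff (m - k) (qPochhammer b) := by
  induction k with
  | zero => simpa using boundedSum_zero_mul_coeff m 0
  | succ k ih =>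
    rw [Finset.sum_range_succ, ih (by omega)]
    obtain ⟨j, rfl⟩ : ∃ j, m = k + 1 + j := ⟨m - (k + 1), by omega⟩
    rw [show k + 1 + j + 1 - (k + 1) = j + 1 by omega, show k + 1 + j - k = j + 1 by omega,
      show k + 1 + j - (k + 1) = j by omega, boundedSum_mul_coeff]
    have : (Finset.range (k + 1 + 1)).filter (· < k + 1) = Finset.range (k + 1) := by
      ext a
      simp only [Finset.mem_filter, Finset.mem_range]
      omega
    rw [this]
    ring

/-- At the last stage of the telescoping the coefficients are constant terms, equal to 1, and the
remainder is the recursion for `boundedSum (m + 1) (m + 1)`. -/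
theorem boundedSum_eq_qCatalan (m : ℕ) : boundedSum m m = qCatalan m := by
  have h : IsQCatalanSeq fun m => boundedSum m m := by
    rw [isQCatalanSeq_iff]
    rintro (- | m)
    · simp [boundedSum]
    · rw [Fin.sum_univ_eq_sum_range (fun k => boundedSum k k
        * PowerSeries.coeff (m + 1 - k) (qPochhammer (k + 1))), sum_boundedSum_mul_coeff m m le_rfl]
      simp only [Nat.sub_self, qPochhammer_coeff_zero, mul_one]
      simp only [Nat.add_eq_zero_iff, one_ne_zero, and_false, if_false, zero_sub, neg_neg,
        boundedSum]
      refine Finset.sum_congr (Finset.ext fun a => ?_) fun _ _ => rfl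
      simp only [Finset.mem_filter, Finset.mem_range]
      omega
  exact congrFun h.eq_qCatalan m

/-- The sequences `e` with `e i ≤ i`. -/
def subexcedant (n : ℕ) : Finset (Fin n → ℕ) :=
  Fintype.piFinset fun i : Fin n => Finset.range ((i : ℕ) + 1)

theorem mem_subexcedant {n : ℕ} {e : Fin n → ℕ} : e ∈ subexcedant n ↔ ∀ i, e i ≤ i := by
  simp [subexcedant]

theorem card_subexcedant (n : ℕ) : (subexcedant n).card = n.factorial := by
  rw [subexcedant, Fintype.card_piFinset]
  simp only [Finset.card_range]
  rw [Fin.prod_univ_eq_prod_range (fun i => i + 1), Finset.prod_range_add_one_eq_factorial]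

open Classical in
theorem boundedSum_eq_sum (m x : ℕ) : boundedSum m x =
    ∑ e ∈ (subexcedant m).filter (fun e => Monotone e ∧ ∀ i, e i ≤ x),
      (Polynomial.X : ℤ[X]) ^ (∑ i, e i) := by
  induction m generalizing x with
  | zero =>
    have : (subexcedant 0).filter (fun e => Monotone e ∧ ∀ i, e i ≤ x) = {Fin.elim0} := by
      ext e
      simp only [Finset.mem_filter, mem_subexcedant, Finset.mem_singleton]
      exact ⟨fun _ => Subsingleton.elim _ _,
        fun _ => ⟨fun i => i.elim0, fun i => i.elim0, fun i => i.elim0⟩⟩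
    rw [this]
    simp [boundedSum]
  | succ m ih =>
    simp only [boundedSum, ih, Finset.mul_sum]
    rw [Finset.sum_sigma']
    refine Finset.sum_bij' (fun p _ => (Fin.snoc p.2 p.1 : Fin (m + 1) → ℕ))
      (fun e _ => ⟨e (Fin.last m), fun i => e i.castSucc⟩) ?_ ?_ ?_ ?_ ?_
    · rintro ⟨a, e⟩ h
      simp only [Finset.mem_sigma, Finset.mem_filter, Finset.mem_range, mem_subexcedant] at h ⊢
      obtain ⟨⟨h1, h2⟩, h3, h4, h5⟩ := h
      refine ⟨fun i => ?_, fun i j hij => ?_, fun i => ?_⟩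
      · induction i using Fin.lastCases with
        | last => simpa using Nat.lt_succ_iff.1 h1
        | cast i => simpa using h3 i
      · induction j using Fin.lastCases with
        | last =>
          induction i using Fin.lastCases with
          | last => simp
          | cast i => simpa using h5 i
        | cast j =>
          induction i using Fin.lastCases with
          | last => exact absurd hij (by simp [Fin.le_def])
          | cast i => simpa using h4 (by simpa using hij)
      · induction i using Fin.lastCases with
        | last => simpa using h2
        | cast i => simpa using (h5 i).trans h2
    · intro e h
      simp only [Finset.mem_sigma, Finset.mem_filter, Finset.mem_range, mem_subexcedant] at h ⊢
      obtain ⟨h1, h2, h3⟩ := h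
      refine ⟨⟨?_, h3 _⟩, fun i => by simpa using h1 i.castSucc,
        fun i j hij => h2 (by simpa using hij), fun i => h2 (Fin.le_last _)⟩
      have := h1 (Fin.last m)
      simp only [Fin.val_last] at this
      omega
    · rintro ⟨a, e⟩ h
      simp
    · intro e h
      funext i
      induction i using Fin.lastCases <;> simp
    · rintro ⟨a, e⟩ h
      rw [← pow_add]
      simp [Fin.sum_univ_castSucc, add_comm]

open Classical in
theorem qCatalan_eq_sum (m : ℕ) : qCatalan m =
    ∑ e ∈ (subexcedant m).filter Monotone, (Polynomial.X : ℤ[X]) ^ (∑ i, e i) := by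
  rw [← boundedSum_eq_qCatalan, boundedSum_eq_sum]
  refine Finset.sum_congr (Finset.filter_congr fun e he => ?_) fun _ _ => rfl
  rw [mem_subexcedant] at he
  exact ⟨And.left, fun h => ⟨h, fun i => (he i).trans i.2.le⟩⟩

/-! ### Bijectivity and 231-avoidance -/

section Perm

variable {n : ℕ}

theorem image_smallerBefore : Finset.univ.image
    (smallerBefore : Equiv.Perm (Fin n) → Fin n → ℕ) = subexcedant n := by
  refine Finset.eq_of_subset_of_card_le (fun e he => ?_) ?_
  · obtain ⟨w, -, rfl⟩ := Finset.mem_image.1 he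
    exact mem_subexcedant.2 (smallerBefore_le w)
  · rw [card_subexcedant, Finset.card_image_of_injective _ smallerBefore_injective,
      Finset.card_univ, Fintype.card_perm, Fintype.card_fin]

theorem exists_permCode_eq {c : ℕ → ℕ} (hc : IsCode n c) :
    ∃ w : Equiv.Perm (Fin n), permCode w = c := by
  have hle : ∀ i : Fin n, c (Fin.rev i) ≤ i := fun i => by
    by_contra h
    have := hc _ _ (not_le.1 h)
    rw [Fin.val_rev] at this
    omega
  have he : (fun i : Fin n => (i : ℕ) - c (Fin.rev i)) ∈ subexcedant n :=
    mem_subexcedant.2 fun i => Nat.sub_le _ _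
  rw [← image_smallerBefore] at he
  obtain ⟨w, -, hw⟩ := Finset.mem_image.1 he
  refine ⟨w, funext fun b => ?_⟩
  by_cases hb : b < n
  · obtain ⟨i, rfl⟩ : ∃ i : Fin n, b = Fin.rev i := ⟨Fin.rev ⟨b, hb⟩, by simp⟩
    rw [permCode_rev]
    have h1 := congrFun hw i
    have h2 := greaterBefore_add_smallerBefore w i
    have h3 := hle i
    omega
  · rw [permCode, dif_neg hb]
    by_contra h
    have := hc b 0 (by omega)
    omega

/-- The code of `T` is that of some `w'`, so `T` corresponds to `w'` as well, and uniqueness forces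
`w' = w`. -/
theorem corresponds_iff {w : Equiv.Perm (Fin n)} {T : DyckTiling n} :
    T.Corresponds w ↔ T = permTiling w := by
  constructor
  · intro h
    obtain ⟨w', hw'⟩ := exists_permCode_eq T.isCode_code
    have hT : T = permTiling w' := by
      conv_lhs => rw [T.eq_codeTiling]
      simp only [permTiling, hw']
    have h' : T.Corresponds w' := hT ▸ permTiling_corresponds w'
    rw [h.unique h', hT]
  · rintro rfl
    exact permTiling_corresponds w

theorem weight_permTiling (w : Equiv.Perm (Fin n)) :
    (permTiling w).weight = ∑ i, greaterBefore w i := by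
  rw [permTiling, codeTiling_weight, ← Fin.sum_univ_eq_sum_range (permCode w),
    ← Equiv.sum_comp Fin.revPerm]
  simp only [Fin.revPerm_apply, permCode_rev]

theorem weight_permTiling_add (w : Equiv.Perm (Fin n)) :
    (permTiling w).weight + ∑ i, smallerBefore w i = n.choose 2 := by
  rw [weight_permTiling, ← Finset.sum_add_distrib]
  simp only [greaterBefore_add_smallerBefore]
  rw [Fin.sum_univ_eq_sum_range (fun i => i), Finset.sum_range_id, Nat.choose_two_right]

/-- A letter before `j` smaller than `w j` must also be smaller than `w k`, for otherwise the three
form the pattern 231. -/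
theorem smallerBefore_le_of_avoids {w : Equiv.Perm (Fin n)}
    (hw : ∀ i j k : Fin n, i < j → j < k → ¬ (w k < w i ∧ w i < w j)) {j k : Fin n} (h : j < k) :
    smallerBefore w j ≤ smallerBefore w k := by
  refine Finset.card_le_card (Finset.monotone_filter_right _ fun i _ hi => ⟨hi.1.trans h, ?_⟩)
  by_contra h1
  rcases (not_lt.1 h1).lt_or_eq with h2 | h2
  · exact hw i j k hi.1 h ⟨h2, hi.2⟩
  · exact (hi.1.trans h).ne (w.injective h2).symm

/-- A 231 pattern can be moved until its last two letters are adjacent. There the count drops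
strictly: every letter counted at the right one is counted at the left one, and `i` only at the left
one. -/
theorem avoids_of_monotone {w : Equiv.Perm (Fin n)} (hw : Monotone (smallerBefore w))
    (i j k : Fin n) (hij : i < j) (hjk : j < k) : ¬ (w k < w i ∧ w i < w j) := by
  obtain ⟨m, hm⟩ : ∃ m : ℕ, (j : ℕ) + m + 1 = k := ⟨k - j - 1, by rw [Fin.lt_def] at hjk; omega⟩
  induction m generalizing j with
  | zero =>
    rintro ⟨h1, h2⟩
    refine (hw hjk.le).not_gt (Finset.card_lt_card ?_)
    rw [Finset.ssubset_iff_of_subset]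
    · exact ⟨i, by simpa using ⟨hij, h2⟩, by simpa using fun _ => h1.le⟩
    · refine Finset.monotone_filter_right _ fun l _ hl => ⟨?_, hl.2.trans (h1.trans h2)⟩
      have h3 : l ≠ j := by
        rintro rfl
        exact lt_asymm hl.2 (h1.trans h2)
      have h4 := hl.1
      rw [Ne, Fin.ext_iff] at h3
      rw [Fin.lt_def] at h4 ⊢
      omega
  | succ m ih =>
    rintro ⟨h1, h2⟩
    have hj1 : (j : ℕ) + 1 < n := by omega
    have hjj : j < ⟨j + 1, hj1⟩ := by
      rw [Fin.lt_def]
      simp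
    have hne : w i ≠ w ⟨j + 1, hj1⟩ := fun h => (hij.trans hjj).ne (w.injective h)
    -- Either position `j + 1` can replace `j`, closer to `k`, or it can replace `k` and the count
    -- already drops there.
    rcases lt_or_gt_of_ne hne with h | h
    · exact ih ⟨j + 1, hj1⟩ (hij.trans hjj) (by rw [Fin.lt_def]; simp only; omega)
        (by simp only; omega) ⟨h1, h⟩
    · refine (hw hjj.le).not_gt (Finset.card_lt_card ?_)
      rw [Finset.ssubset_iff_of_subset]
      · exact ⟨i, by simpa using ⟨hij, h2⟩, by simpa using fun _ => h.le⟩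
      · refine Finset.monotone_filter_right _ fun l _ hl => ⟨?_, hl.2.trans (h.trans h2)⟩
        have h3 : l ≠ j := by
          rintro rfl
          exact lt_asymm hl.2 (h.trans h2)
        have h4 := hl.1
        rw [Ne, Fin.ext_iff] at h3
        rw [Fin.lt_def] at h4 ⊢
        simp only at h4
        omega

theorem mem_perms231Avoiding_iff {w : Equiv.Perm (Fin n)} :
    w ∈ perms231Avoiding n ↔ Monotone (smallerBefore w) := by
  rw [perms231Avoiding, Finset.mem_filter, and_iff_right (Finset.mem_univ w)]
  exact ⟨fun h i j hij => hij.lt_or_eq.elim (smallerBefore_le_of_avoids h) fun h => h ▸ le_rfl,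
    avoids_of_monotone⟩

open Classical in
theorem image_perms231Avoiding :
    (perms231Avoiding n).image smallerBefore = (subexcedant n).filter Monotone := by
  rw [← image_smallerBefore, Finset.filter_image]
  congr 1
  ext w
  simp [mem_perms231Avoiding_iff]

theorem sum_perms231Avoiding : ∑ w ∈ perms231Avoiding n,
    (LaurentPolynomial.T ((permTiling w).weight : ℤ) : ℤ[T;T⁻¹]) =
      LaurentPolynomial.T ((n.choose 2 : ℕ) : ℤ) *
        LaurentPolynomial.invert (Polynomial.toLaurent (qCatalan n)) := by
  classical
  rw [qCatalan_eq_sum, ← image_perms231Avoiding,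
    Finset.sum_image fun _ _ _ _ h => smallerBefore_injective h, map_sum, map_sum, Finset.mul_sum]
  refine Finset.sum_congr rfl fun w _ => ?_
  rw [Polynomial.toLaurent_X_pow, LaurentPolynomial.invert_T, ← LaurentPolynomial.T_add,
    ← weight_permTiling_add w]
  congr 1
  push_cast
  ring

end Perm

theorem mainTheorem10 (n : ℕ) :
    ∃ D : Equiv.Perm (Fin n) → DyckTiling n,
      (∀ (w : Equiv.Perm (Fin n)) (T : DyckTiling n), T.Corresponds w ↔ T = D w) ∧
      ∑ w ∈ perms231Avoiding n, (LaurentPolynomial.T ((D w).weight : ℤ) : ℤ[T;T⁻¹]) =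
        LaurentPolynomial.T ((n.choose 2 : ℕ) : ℤ) *
          LaurentPolynomial.invert (Polynomial.toLaurent (qCatalan n)) :=
  ⟨permTiling, fun _ _ => corresponds_iff, sum_perms231Avoiding⟩
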